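/- Fix $\hbar\in\mathbb C\setminus\{0\}$ and $n\ge 1$, and let $N=2n$, or $N=2n-1$ with $n\ge 2$. Let $Q_1,\dots,Q_n$ be meromorphic functions on $\mathbb C$, not identically zero, with $Q_a(u+\frac{\pi i}{\hbar})=h_aQ_a(u)$ for constants $h_a\in\mathbb C$. Put $Y_0=1$, $Y_a(u)=Q_a(u-1)/Q_a(u+1)$ and $Y_n^2(u)=Y_n(u)Y_n(u+\frac{\pi i}{2\hbar})$. Define $x_1,\dots,x_{N+1}$ as follows. For $A^{(2)}_{2n}$ ($N=2n$): $$x_a(u)=\frac{Y_a(u+a)}{Y_{a-1}(u+a+1)},\qquad x_{2n+2-a}(u)=\frac{Y_{a-1}(u+2n-a+2+\frac{\pi i}{2\hbar})}{Y_a(u+2n-a+3+\frac{\pi i}{2\hbar})}\qquad(1\le a\le n),$$ $$x_{n+1}(u)=\frac{Y_n(u+n+1+\frac{\pi i}{2\hbar})}{Y_n(u+n+2)}.$$ For $A^{(2)}_{2n-1}$ ($N=2n-1$): $$x_a(u)=\frac{Y_a(u+a)}{Y_{a-1}(u+a+1)},\qquad x_{2n+1-a}(u)=\frac{Y_{a-1}(u+2n-a+1+\frac{\pi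 i}{2\hbar})}{Y_a(u+2n-a+2+\frac{\pi i}{2\hbar})}\qquad(1\le a\le n-1),$$ $$x_n(u)=\frac{Y_n^2(u+n)}{Y_{n-1}(u+n+1)},\qquad x_{n+1}(u)=\frac{Y_{n-1}(u+n+1+\frac{\pi i}{2\hbar})}{Y_n^2(u+n+2)}.$$ Let $D$ be the operator $(Df)(u)=f(u+2)$, and let $$L(u)=(1-x_{N+1}(u)D)\cdots(1-x_2(u)D)(1-x_1(u)D).$$ With $x_b'(u)=x_b(u+N+1-2b+\frac{\pi i}{2\hbar})$, let $$L_a(u)=(D-x'_{N+2-a}(u))\cdots(D-x'_{N}(u))(D-x'_{N+1}(u))\qquad(1\le a\le N+1).$$ Let $w_1,\dots,w_{N+1}$ be a basis, over the field of $2$-periodic meromorphic functions, of the space of meromorphic solutions $w$ of $L(u)w(u)=0$, such that $L_a(u)w_b(u)=0$ for $1\le b\le a\le N+1$. For integers $i_1,\dots,i_{N+1}$ let $[i_1,\dots,i_{N+1}]$ be the Casorati determinant $\det\big(w_j(u+2i_k)\big)_{1\le j,k\le N+1}$, a meromorphic function of $u$, and put $$\xi^{(a)}_m(u)=[0,1,\dots,a-1,a+m,a+m+1,\dots,N+m],\qquad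 \xi(u)=[0,1,\dots,N].$$ Then $\xi\not\equiv 0$, and the meromorphic functions $$T^{(a)}_m(u)=\frac{\xi^{(a)}_m(u-a-m+1)}{\xi(u-a-m+1)}$$ satisfy the boundary conditions $T^{(a)}_{-1}=0$ and $T^{(a)}_0=1$ for $1\le a\le n$, and $T^{(0)}_m=1$ for $m\ge 0$. Moreover, for all integers $m\ge1$, they satisfy the $T$-system of $U_q(A^{(2)}_N)$ with $q=e^{\hbar}$, namely $$T^{(a)}_m(u-1)T^{(a)}_m(u+1)=T^{(a)}_{m-1}(u)T^{(a)}_{m+1}(u)+T^{(a-1)}_m(u)T^{(a+1)}_m(u)\qquad(1\le a\le n-1),$$ and, for $a=n$, $$T^{(n)}_m(u-1)T^{(n)}_m(u+1)=T^{(n)}_{m-1}(u)T^{(n)}_{m+1}(u)+T^{(n-1)}_m(u)\,T^{(n)}_m(u+\tfrac{\pi i}{2\hbar})\quad\text{if }N=2n,$$ $$T^{(n)}_m(u-1)T^{(n)}_m(u+1)=T^{(n)}_{m-1}(u)T^{(n)}_{m+1}(u)+T^{(n-1)}_m(u)\,T^{(n-1)}_m(u+\tfrac{\pi i}{2\hbar})\quad\text{if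 }N=2n-1.$$ -/

import Mathlib

open Filter Topology

noncomputable section

namespace TwistedT

/-! ### The field of meromorphic functions on the complex plane -/

/-- The ring of functions `ℂ → ℂ` that are meromorphic on the whole plane. -/
def merFun : Subring (ℂ → ℂ) where
  carrier := {f | Meromorphic f}
  mul_mem' hf hg := Meromorphic.mul hf hg
  one_mem' := Meromorphic.const 1
  add_mem' hf hg := Meromorphic.add hf hg
  zero_mem' := Meromorphic.const 0
  neg_mem' hf := Meromorphic.neg hf

/-- Meromorphic functions up to equality off a closed discrete set (the values that Lean gives
to a function at its poles carry no information). -/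
def merSubring : Subring ((codiscrete ℂ).Germ ℂ) :=
  merFun.map (Germ.coeRingHom (codiscrete ℂ))

/-- The field of meromorphic functions of `u ∈ ℂ`. -/
abbrev Mero : Type := merSubring

theorem coe_mem_merSubring {f : ℂ → ℂ} (hf : Meromorphic f) :
    (f : (codiscrete ℂ).Germ ℂ) ∈ merSubring := ⟨f, hf, rfl⟩

/-- The element of `Mero` given by a meromorphic function. -/
def Mero.mk (f : ℂ → ℂ) (hf : Meromorphic f) : Mero :=
  ⟨(f : (codiscrete ℂ).Germ ℂ), coe_mem_merSubring hf⟩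

theorem Mero.exists_mk (x : Mero) : ∃ f hf, x = Mero.mk f hf := by
  obtain ⟨_, f, hf, rfl⟩ := x
  exact ⟨f, hf, rfl⟩

theorem Mero.mk_eq_mk {f g : ℂ → ℂ} {hf : Meromorphic f} {hg : Meromorphic g} :
    Mero.mk f hf = Mero.mk g hg ↔ f =ᶠ[codiscrete ℂ] g :=
  Subtype.ext_iff.trans Germ.coe_eq

theorem Mero.isUnit_or_eq_zero (x : Mero) : IsUnit x ∨ x = 0 := by
  obtain ⟨f, hf, rfl⟩ := x.exists_mk
  by_cases h : ∃ u ∈ (Set.univ : Set ℂ), meromorphicOrderAt f u ≠ ⊤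
  · left
    have hne : ∀ᶠ x in codiscrete ℂ, f x ≠ 0 :=
      hf.meromorphicOn.eventually_codiscreteWithin_apply_ne_zero
        ((hf.meromorphicOn.exists_meromorphicOrderAt_ne_top_iff_forall_mem
          isConnected_univ).1 h)
    refine IsUnit.of_mul_eq_one (Mero.mk f⁻¹ hf.inv) ?_
    apply Subtype.ext
    change ((f * f⁻¹ : ℂ → ℂ) : (codiscrete ℂ).Germ ℂ) = ((1 : ℂ → ℂ) : (codiscrete ℂ).Germ ℂ)
    refine Germ.coe_eq.2 ?_
    filter_upwards [hne] with u hu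
    simp [hu]
  · right
    push Not at h
    apply Subtype.ext
    change ((f : ℂ → ℂ) : (codiscrete ℂ).Germ ℂ) = ((0 : ℂ → ℂ) : (codiscrete ℂ).Germ ℂ)
    refine Germ.coe_eq.2 (mem_codiscrete.2 fun u => ?_)
    rw [disjoint_principal_right, compl_compl]
    exact meromorphicOrderAt_eq_top_iff.1 (h u (Set.mem_univ u))

instance : (codiscrete ℂ).NeBot := by
  refine ⟨fun h => ?_⟩
  have h0 : (∅ : Set ℂ) ∈ codiscrete ℂ := h ▸ mem_bot
  have h1 := mem_codiscrete.1 h0 0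
  rw [Set.compl_empty, principal_univ, disjoint_top] at h1
  exact (NeBot.ne inferInstance : 𝓝[≠] (0 : ℂ) ≠ ⊥) h1

instance : Nontrivial Mero := inferInstance

instance : Field Mero := Field.ofIsUnitOrEqZero Mero.isUnit_or_eq_zero

theorem tendsto_add_codiscrete (c : ℂ) :
    Tendsto (fun u : ℂ => u + c) (codiscrete ℂ) (codiscrete ℂ) := by
  intro S hS
  rw [mem_codiscrete] at hS
  rw [mem_map, mem_codiscrete]
  intro u
  have h := hS (u + c)
  rw [disjoint_principal_right, compl_compl] at h ⊢
  have ht : Tendsto (fun u : ℂ => u + c) (𝓝[≠] u) (𝓝[≠] (u + c)) := by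
    refine tendsto_nhdsWithin_iff.2 ⟨?_, ?_⟩
    · exact ((continuous_add_const c).tendsto u).mono_left nhdsWithin_le_nhds
    · filter_upwards [self_mem_nhdsWithin] with v hv
      simpa using hv
  exact ht h

/-- Translation `f(u) ↦ f(u + c)` on germs along the codiscrete filter. -/
def germShift (c : ℂ) : (codiscrete ℂ).Germ ℂ →+* (codiscrete ℂ).Germ ℂ where
  toFun f := f.compTendsto (fun u => u + c) (tendsto_add_codiscrete c)
  map_one' := rfl
  map_zero' := rfl
  map_mul' f g := by
    induction f using Germ.inductionOn
    induction g using Germ.inductionOn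
    rfl
  map_add' f g := by
    induction f using Germ.inductionOn
    induction g using Germ.inductionOn
    rfl

theorem meromorphic_translate (c : ℂ) {f : ℂ → ℂ} (hf : Meromorphic f) :
    Meromorphic fun u => f (u + c) :=
  fun x => meromorphicAt_comp_add_const_iff_meromorphicAt.2 (hf (x + c))

/-- Translation of meromorphic functions: `shift c f` is the function `u ↦ f(u + c)`. -/
def shift (c : ℂ) : Mero →+* Mero :=
  (germShift c).restrict merSubring merSubring (by
    rintro _ ⟨f, hf, rfl⟩
    exact coe_mem_merSubring (meromorphic_translate c hf))

theorem shift_mk (c : ℂ) (f : ℂ → ℂ) (hf : Meromorphic f) :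
    shift c (Mero.mk f hf) = Mero.mk (fun u => f (u + c)) (meromorphic_translate c hf) := rfl

/-- The constant function with value `c`. -/
def const (c : ℂ) : Mero := Mero.mk (fun _ => c) (Meromorphic.const c)

/-! ### The variables -/

/-- The half period `π i / (2 ħ)`. -/
def halfPeriod (ħ : ℂ) : ℂ := Real.pi * Complex.I / (2 * ħ)

/-- `Y_0 = 1` and `Y_a(u) = Q_a(u - 1) / Q_a(u + 1)` for `a ≥ 1`
(all roots of `A_N` have square length `2`). -/
def Y (Q : ℕ → Mero) : ℕ → Mero
  | 0 => 1
  | a + 1 => shift (-1) (Q (a + 1)) / shift 1 (Q (a + 1))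

/-- `Y_a^2(u) = Y_a(u) Y_a(u + π i / (2 ħ))`. -/
def YY (ħ : ℂ) (Q : ℕ → Mero) (a : ℕ) : Mero := Y Q a * shift (halfPeriod ħ) (Y Q a)

/-- The variables `x_b(u)`, `1 ≤ b ≤ 2n + 1`, for `A^{(2)}_{2n}`: here `x_b = z_b` for
`1 ≤ b ≤ n`, `x_{n+1} = z_0`, and `x_{2n+2-a} = z_{\bar a}` for `1 ≤ a ≤ n`. -/
def xEven (n : ℕ) (ħ : ℂ) (Q : ℕ → Mero) (b : ℕ) : Mero :=
  if b ≤ n then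
    shift b (Y Q b) / shift (b + 1) (Y Q (b - 1))
  else if b = n + 1 then
    shift (n + 1 + halfPeriod ħ) (Y Q n) / shift (n + 2) (Y Q n)
  else
    let a : ℕ := 2 * n + 2 - b
    shift (2 * n - a + 2 + halfPeriod ħ) (Y Q (a - 1)) /
      shift (2 * n - a + 3 + halfPeriod ħ) (Y Q a)

/-- The variables `x_b(u)`, `1 ≤ b ≤ 2n`, for `A^{(2)}_{2n-1}`: here `x_b = z_b` for
`1 ≤ b ≤ n`, and `x_{2n+1-a} = z_{\bar a}` for `1 ≤ a ≤ n`. -/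
def xOdd (n : ℕ) (ħ : ℂ) (Q : ℕ → Mero) (b : ℕ) : Mero :=
  if b < n then
    shift b (Y Q b) / shift (b + 1) (Y Q (b - 1))
  else if b = n then
    shift n (YY ħ Q n) / shift (n + 1) (Y Q (n - 1))
  else if b = n + 1 then
    shift (n + 1 + halfPeriod ħ) (Y Q (n - 1)) / shift (n + 2) (YY ħ Q n)
  else
    let a : ℕ := 2 * n + 1 - b
    shift (2 * n - a + 1 + halfPeriod ħ) (Y Q (a - 1)) /
      shift (2 * n - a + 2 + halfPeriod ħ) (Y Q a)

/-! ### Difference operators -/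

/-- The field of `2`-periodic meromorphic functions, the constants of `D`. -/
def PeriodTwo : Subfield Mero := (shift 2).eqLocusField (RingHom.id Mero)

/-- The difference operator `(D f)(u) = f(u + 2)`. -/
def D : Module.End PeriodTwo Mero where
  toFun f := shift 2 f
  map_add' f g := map_add _ f g
  map_smul' p f := by
    have hp : shift 2 (p : Mero) = p := p.2
    change shift 2 ((p : Mero) * f) = (p : Mero) * shift 2 f
    rw [map_mul, hp]

/-- The operator of multiplication by a meromorphic function. -/
def mulOp (x : Mero) : Module.End PeriodTwo Mero := LinearMap.mulLeft PeriodTwo x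

/-- `Lop x k = (1 - x_k(u) D) ⋯ (1 - x_2(u) D) (1 - x_1(u) D)`; thus `L(u) = Lop x (N + 1)`. -/
def Lop (x : ℕ → Mero) : ℕ → Module.End PeriodTwo Mero
  | 0 => 1
  | k + 1 => (1 - mulOp (x (k + 1)) * D) * Lop x k

/-- `L_a(u) = (D - x'_{N+2-a}(u)) ⋯ (D - x'_N(u)) (D - x'_{N+1}(u))`, where
`x'_b(u) = x_b(u + N + 1 - 2b + π i / (2 ħ))`. -/
def Lpart (N : ℕ) (ħ : ℂ) (x : ℕ → Mero) : ℕ → Module.End PeriodTwo Mero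
  | 0 => 1
  | a + 1 =>
    let b : ℕ := N + 1 - a
    (D - mulOp (shift (N + 1 - 2 * b + halfPeriod ħ) (x b))) * Lpart N ħ x a

/-! ### Casorati determinants -/

/-- The Casorati determinant `[i_1, …, i_{N+1}]`, whose `(j, k)` entry is `w_j(u + 2 i_k)`. -/
def casorati {N : ℕ} (w : Fin (N + 1) → Mero) (i : Fin (N + 1) → ℤ) : Mero :=
  Matrix.det (Matrix.of fun j k => shift (2 * (i k : ℂ)) (w j))

/-- `ξ^{(a)}_m = [0, 1, …, a-1, a+m, a+m+1, …, N+m]`. -/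
def xi {N : ℕ} (w : Fin (N + 1) → Mero) (a : ℕ) (m : ℤ) : Mero :=
  casorati w fun k => if (k : ℕ) < a then (k : ℤ) else (k : ℤ) + m

/-- `ξ = [0, 1, …, N]`. -/
def xi0 {N : ℕ} (w : Fin (N + 1) → Mero) : Mero :=
  casorati w fun k => (k : ℤ)

/-- `T^{(a)}_m(u) = ξ^{(a)}_m(u - a - m + 1) / ξ(u - a - m + 1)`. -/
def T {N : ℕ} (w : Fin (N + 1) → Mero) (a : ℕ) (m : ℤ) : Mero :=
  shift (-a - m + 1) (xi w a m) / shift (-a - m + 1) (xi0 w)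

/-! ### The twisted `T`-systems -/

/-- The boundary conditions of the `T`-system: `T^{(a)}_{-1} = 0` and `T^{(a)}_0 = 1`
for `1 ≤ a ≤ n`, and `T^{(0)}_m = 1`. -/
structure IsBoundary (n : ℕ) (T : ℕ → ℤ → Mero) : Prop where
  neg_one : ∀ a, 1 ≤ a → a ≤ n → T a (-1) = 0
  zero : ∀ a, 1 ≤ a → a ≤ n → T a 0 = 1
  left : ∀ m : ℤ, 0 ≤ m → T 0 m = 1

/-- The `T`-system for `A^{(2)}_{2n}`. -/
structure IsTSystemEven (n : ℕ) (ħ : ℂ) (T : ℕ → ℤ → Mero) : Prop where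
  boundary : IsBoundary n T
  bulk : ∀ (a : ℕ) (m : ℤ), 1 ≤ a → a + 1 ≤ n → 1 ≤ m →
    shift (-1) (T a m) * shift 1 (T a m) =
      T a (m - 1) * T a (m + 1) + T (a - 1) m * T (a + 1) m
  last : ∀ m : ℤ, 1 ≤ m →
    shift (-1) (T n m) * shift 1 (T n m) =
      T n (m - 1) * T n (m + 1) + T (n - 1) m * shift (halfPeriod ħ) (T n m)

/-- The `T`-system for `A^{(2)}_{2n-1}`. -/
structure IsTSystemOdd (n : ℕ) (ħ : ℂ) (T : ℕ → ℤ → Mero) : Prop where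
  boundary : IsBoundary n T
  bulk : ∀ (a : ℕ) (m : ℤ), 1 ≤ a → a + 1 ≤ n → 1 ≤ m →
    shift (-1) (T a m) * shift 1 (T a m) =
      T a (m - 1) * T a (m + 1) + T (a - 1) m * T (a + 1) m
  last : ∀ m : ℤ, 1 ≤ m →
    shift (-1) (T n m) * shift 1 (T n m) =
      T n (m - 1) * T n (m + 1) + T (n - 1) m * shift (halfPeriod ħ) (T (n - 1) m)

/-- `w_1, …, w_{N+1}` is a basis, over the `2`-periodic functions, of the space of solutions of
`L(u) w(u) = 0`, adapted to the operators `L_a`: `L_a(u) w_b(u) = 0` for `1 ≤ b ≤ a ≤ N + 1`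
(the index `j : Fin (N + 1)` stands for `b = j + 1`). -/
structure IsAdaptedBasis {N : ℕ} (ħ : ℂ) (x : ℕ → Mero) (w : Fin (N + 1) → Mero) : Prop where
  linearIndependent : LinearIndependent PeriodTwo w
  span_eq : Submodule.span PeriodTwo (Set.range w) = LinearMap.ker (Lop x (N + 1))
  adapted : ∀ (a : ℕ) (j : Fin (N + 1)), a ≤ N + 1 → (j : ℕ) + 1 ≤ a → Lpart N ħ x a (w j) = 0

end TwistedT

end

noncomputable section

namespace TwistedT

/-! ### Determinant identities -/

section Determinants

variable {R : Type*} [CommRing R]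

/-! Write $L=\sum_k c_kD^k$. Since $Lw_j=0$, the rows $(w_j(u+2k))_k$ are orthogonal to the
coefficient rows of the operators $D^iL$, so complementary minors of the two families are
proportional (`det_skip_columns`). Here $c_0=1$, and the $x_b$ telescope to $c_{N+1}=(-1)^{N+1}$
(`lopCoeff_xEven`, `lopCoeff_xOdd`); hence $(-1)^{am}T^{(a)}_m$ is a Jacobi–Trudi determinant in the
$c_k$ (`T_natCast`). Dodgson condensation of that determinant is the untwisted $T$-system of $A_N$,
valid at every node $1\le a\le N$ (`IsAdaptedBasis.T_mul_T`).

The twist comes from $L_{N+1}$, which kills the same $w_j$ and whose coefficients are translates of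
those of $L$ in reverse order. Two operators of order $N+1$ that share $N+1$ solutions with nonzero
Casoratian (`casorati_det_ne_zero`) are proportional, so $c_{N+1-k}$ is a translate of $c_k$ up to
sign (`lopCoeff_dual`). Transposing the determinants gives $T^{(N+1-a)}_m(u)=T^{(a)}_m(u+\frac{\pi
i}{2\hbar})$ (`IsAdaptedBasis.T_dual`), and substituting this at node $n+1$ closes the system at
node $n$. -/

theorem det_mul_det_toBlocks₁₁_adjugate {m p : Type*} [Fintype m] [Fintype p] [DecidableEq m]
    [DecidableEq p] (M : Matrix (m ⊕ p) (m ⊕ p) R) :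
    M.det * M.adjugate.toBlocks₁₁.det = M.det ^ Fintype.card m * M.toBlocks₂₂.det := by
  have h := Matrix.mul_adjugate M
  -- The right factor is the first block column of the adjugate completed by an identity block; its
  -- determinant is that of the adjugate block, and the product is block triangular.
  have h1 : M * Matrix.fromBlocks M.adjugate.toBlocks₁₁ 0 M.adjugate.toBlocks₂₁ 1 =
      Matrix.fromBlocks (M.det • 1) M.toBlocks₁₂ 0 M.toBlocks₂₂ := by
    conv_lhs => enter [1]; rw [← Matrix.fromBlocks_toBlocks M]
    have hM : M * M.adjugate = Matrix.fromBlocks M.toBlocks₁₁ M.toBlocks₁₂ M.toBlocks₂₁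
        M.toBlocks₂₂ * Matrix.fromBlocks M.adjugate.toBlocks₁₁ M.adjugate.toBlocks₁₂
        M.adjugate.toBlocks₂₁ M.adjugate.toBlocks₂₂ := by
      rw [Matrix.fromBlocks_toBlocks, Matrix.fromBlocks_toBlocks]
    rw [hM, Matrix.fromBlocks_multiply] at h
    rw [Matrix.fromBlocks_multiply]
    rw [← Matrix.fromBlocks_one, Matrix.fromBlocks_smul, Matrix.fromBlocks_inj] at h
    rw [Matrix.fromBlocks_inj]
    refine ⟨h.1, by simp, by simpa using h.2.2.1, by simp⟩
  have h2 := congrArg Matrix.det h1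
  rw [Matrix.det_mul, Matrix.det_fromBlocks_zero₁₂, Matrix.det_fromBlocks_zero₂₁,
    Matrix.det_smul, Matrix.det_one, Matrix.det_one, mul_one, mul_one] at h2
  exact h2

/-- Jacobi's identity for the `2 × 2` minors of the adjugate. -/
theorem det_toBlocks₁₁_adjugate {p : Type*} [Fintype p] [DecidableEq p]
    (M : Matrix (Fin 2 ⊕ p) (Fin 2 ⊕ p) R) :
    M.adjugate.toBlocks₁₁.det = M.det * M.toBlocks₂₂.det := by
  -- Cancelling `det` needs a nonzero divisor, so the identity is proved for the generic matrix over
  -- $\mathbb Z$ and then specialised.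
  set X := Matrix.mvPolynomialX (Fin 2 ⊕ p) (Fin 2 ⊕ p) ℤ
  have hX : X.adjugate.toBlocks₁₁.det = X.det * X.toBlocks₂₂.det := by
    apply mul_left_cancel₀ (Matrix.det_mvPolynomialX_ne_zero (Fin 2 ⊕ p) ℤ)
    rw [det_mul_det_toBlocks₁₁_adjugate, Fintype.card_fin]
    ring
  let f : MvPolynomial ((Fin 2 ⊕ p) × (Fin 2 ⊕ p)) ℤ →+* R :=
    MvPolynomial.eval₂Hom (Int.castRingHom R) fun q => M q.1 q.2
  have hf : f.mapMatrix X = M := by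
    ext i j
    simp [f, X]
  have h := congrArg f hX
  rw [map_mul, RingHom.map_det, RingHom.map_det, RingHom.map_det, hf] at h
  have e1 : f.mapMatrix X.adjugate.toBlocks₁₁ = M.adjugate.toBlocks₁₁ := by
    rw [← hf, ← RingHom.map_adjugate]; rfl
  have e2 : f.mapMatrix X.toBlocks₂₂ = M.toBlocks₂₂ := by
    rw [← hf]; rfl
  rwa [e1, e2] at h

/-- The equivalence that sends `0, 1` to the two ends of `Fin (m + 2)`. -/
def endsEquiv (m : ℕ) : Fin 2 ⊕ Fin m ≃ Fin (m + 2) :=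
  Equiv.ofBijective (Sum.elim ![0, Fin.last (m + 1)] fun i => i.castSucc.succ) <| by
    rw [Fintype.bijective_iff_injective_and_card]
    refine ⟨?_, by simp [add_comm]⟩
    rintro (i | i) (j | j) h
    · fin_cases i <;> fin_cases j <;> simp_all [Fin.ext_iff]
    · fin_cases i <;> simp [Fin.ext_iff] at h; omega
    · fin_cases j <;> simp [Fin.ext_iff] at h; omega
    · simpa [Fin.ext_iff] using h

/-- Dodgson condensation (the Desnanot–Jacobi identity). -/
theorem det_mul_det_interior {m : ℕ} (M : Matrix (Fin (m + 2)) (Fin (m + 2)) R) :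
    M.det * (M.submatrix (fun i : Fin m => i.castSucc.succ) fun i : Fin m => i.castSucc.succ).det =
      (M.submatrix Fin.succ Fin.succ).det * (M.submatrix Fin.castSucc Fin.castSucc).det -
        (M.submatrix Fin.succ Fin.castSucc).det * (M.submatrix Fin.castSucc Fin.succ).det := by
  have h := det_toBlocks₁₁_adjugate (M.submatrix (endsEquiv m) (endsEquiv m))
  rw [Matrix.det_submatrix_equiv_self, Matrix.adjugate_submatrix_equiv_self] at h
  have e2 : (M.submatrix (endsEquiv m) (endsEquiv m)).toBlocks₂₂ =
      M.submatrix (fun i : Fin m => i.castSucc.succ) fun i : Fin m => i.castSucc.succ := rfl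
  rw [← e2, ← h, Matrix.det_fin_two]
  change M.adjugate 0 0 * M.adjugate (Fin.last _) (Fin.last _) -
    M.adjugate 0 (Fin.last _) * M.adjugate (Fin.last _) 0 = _
  simp only [Matrix.adjugate_fin_succ_eq_det_submatrix, Fin.succAbove_zero, Fin.succAbove_last]
  have hs : ((-1 : R) ^ (m + 1)) * (-1) ^ (m + 1) = 1 := by
    rw [← mul_pow]; simp
  have hs2 : ((-1 : R) ^ (m + 1 + (m + 1))) = 1 := by rw [pow_add, hs]
  simp only [Fin.val_zero, Fin.val_last, add_zero, zero_add, pow_zero, hs2]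
  linear_combination (-(M.submatrix Fin.succ Fin.castSucc).det *
    (M.submatrix Fin.castSucc Fin.succ).det) * hs

/-- Successive Laplace expansion along unit rows. -/
theorem det_append_unit_rows {n a : ℕ} (ha : a ≤ n) (m : ℕ) (W : Fin n → ℕ → R) :
    (Matrix.of fun i k : Fin (n + m) =>
      if h : (i : ℕ) < n then W ⟨i, h⟩ k else if (k : ℕ) = a + (i - n) then 1 else 0).det =
    (-1) ^ (m * (n + a)) *
      (Matrix.of fun (i k : Fin n) => W i (if (k : ℕ) < a then k else k + m)).det := by
  induction m generalizing W with
  | zero => simp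
  | succ m ih =>
    change Matrix.det (n := Fin (n + m + 1)) _ = _
    rw [Matrix.det_succ_row _ (Fin.last (n + m)),
      Finset.sum_eq_single (⟨a + m, by omega⟩ : Fin (n + m + 1))]
    · have := ih fun i k => W i (if k < a + m then k else k + 1)
      have e1 : (Matrix.of fun i k : Fin (n + (m + 1)) =>
          if h : (i : ℕ) < n then W ⟨i, h⟩ k else
            if (k : ℕ) = a + (i - n) then (1 : R) else 0).submatrix
            (Fin.last (n + m)).succAbove (Fin.succAbove (⟨a + m, by omega⟩ : Fin (n + m + 1))) =
          Matrix.of fun i k : Fin (n + m) =>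
          if h : (i : ℕ) < n then W ⟨i, h⟩ (if (k : ℕ) < a + m then (k : ℕ) else k + 1) else
            if (k : ℕ) = a + (i - n) then 1 else 0 := by
        ext i k
        have hk : ((Fin.succAbove (⟨a + m, by omega⟩ : Fin (n + m + 1)) k : Fin (n + m + 1)) : ℕ) =
            if (k : ℕ) < a + m then (k : ℕ) else k + 1 := by
          simp only [Fin.succAbove, Fin.lt_def]
          split_ifs <;> simp_all
        simp only [Matrix.submatrix_apply, Matrix.of_apply, Fin.succAbove_last, Fin.val_castSucc]
        rw [hk]
        split_ifs <;> first | rfl | omega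
      have e2 : (Matrix.of fun i k : Fin n => W i
            (if (if (k : ℕ) < a then (k : ℕ) else k + m) < a + m then
              (if (k : ℕ) < a then (k : ℕ) else k + m) else
              (if (k : ℕ) < a then (k : ℕ) else k + m) + 1)) =
          Matrix.of fun i k : Fin n => W i (if (k : ℕ) < a then (k : ℕ) else k + (m + 1)) := by
        ext i k
        simp only [Matrix.of_apply]
        congr 1
        split_ifs <;> omega
      rw [e1, this, e2]
      have hs : (-1 : R) ^ (n + m + (a + m)) * (-1) ^ (m * (n + a)) =
          (-1) ^ ((m + 1) * (n + a)) := by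
        have : (-1 : R) ^ (m + m) = 1 := by rw [← two_mul, pow_mul]; simp
        rw [← pow_add, show n + m + (a + m) + m * (n + a) = (m + m) + (m + 1) * (n + a) by ring,
          pow_add, this, one_mul]
      simp [← hs, mul_assoc]
    · intro b _ hb
      have : (b : ℕ) ≠ a + m := fun h => hb (Fin.ext h)
      simp [this]
    · simp

/-- The Jacobi–Trudi identity: the maximal minor of `W` that skips the columns
`a, …, a + m - 1`, in terms of a banded matrix `B` whose rows are orthogonal to those of `W`. -/
theorem det_skip_columns {n a : ℕ} (ha : a ≤ n) (m : ℕ) (W : Fin n → ℕ → R) (B : ℕ → ℕ → R)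
    (hWB : ∀ j i, i < m → ∑ k : Fin (n + m), W j k * B i k = 0)
    (hB : ∀ i k, n + i < k → B i k = 0) :
    (-1) ^ (m * (n + a)) *
        (Matrix.of fun (i k : Fin n) => W i (if (k : ℕ) < a then k else k + m)).det *
        ∏ i : Fin m, B i (n + i) =
      (Matrix.of fun i k : Fin n => W i k).det *
        (Matrix.of fun i k : Fin m => B i (a + k)).det := by
  rw [← det_append_unit_rows ha]
  set A := Matrix.of fun i k : Fin (n + m) =>
    if h : (i : ℕ) < n then W ⟨i, h⟩ k else if (k : ℕ) = a + (i - n) then (1 : R) else 0 with hA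
  -- $C$ has columns $e_0,\dots,e_{n-1}$ followed by the rows of $B$. It is triangular by the band
  -- condition, and orthogonality makes $AC$ block triangular, so $\det A\det C=\det AC$ is the
  -- claim.
  let C : Matrix (Fin (n + m)) (Fin n ⊕ Fin m) R := Matrix.of fun k q =>
    Sum.elim (fun j : Fin n => if (k : ℕ) = j then 1 else 0) (fun i : Fin m => B i k) q
  let e := (finSumFinEquiv (m := n) (n := m))
  have h1 : A.det = (A.submatrix e e).det := (Matrix.det_submatrix_equiv_self e A).symm
  have h2 : (C.submatrix e id).det = ∏ i : Fin m, B i (n + i) := by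
    have hb : C.submatrix e id = Matrix.fromBlocks 1 (Matrix.of fun (k : Fin n) (i : Fin m) => B i k)
        0 (Matrix.of fun (k : Fin m) (i : Fin m) => B i (n + k)) := by
      ext (i | i) (j | j)
      · simp [C, e, Matrix.one_apply, Fin.ext_iff]
      · simp [C, e]
      · have : (n + i : ℕ) ≠ j := by omega
        simp [C, e, this]
      · simp [C, e]
    rw [hb, Matrix.det_fromBlocks_zero₂₁, Matrix.det_one, one_mul, Matrix.det_of_isUpperTriangular]
    · simp
    · intro i j hij
      exact hB _ _ (by simpa using hij)
  have h3 : (A.submatrix e e) * (C.submatrix e id) = Matrix.fromBlocks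
      (Matrix.of fun i k : Fin n => W i k) 0
      (Matrix.of fun (i : Fin m) (k : Fin n) => if (k : ℕ) = a + i then (1 : R) else 0)
      (Matrix.of fun i k : Fin m => B i (a + k)).transpose := by
    rw [Matrix.submatrix_mul_equiv]
    ext (i | i) (j | j)
    · rw [Matrix.submatrix_apply, Matrix.mul_apply,
        Finset.sum_eq_single (⟨j, by omega⟩ : Fin (n + m))]
      · simp [A, C, e]
      · intro b _ hb
        have : (b : ℕ) ≠ j := fun h => hb (Fin.ext h)
        simp [C, this]
      · simp
    · simpa [A, C, e, Matrix.mul_apply] using hWB i j j.2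
    · rw [Matrix.submatrix_apply, Matrix.mul_apply,
        Finset.sum_eq_single (⟨j, by omega⟩ : Fin (n + m))]
      · simp [A, C, e]
      · intro b _ hb
        have : (b : ℕ) ≠ j := fun h => hb (Fin.ext h)
        simp [C, this]
      · simp
    · rw [Matrix.submatrix_apply, Matrix.mul_apply,
        Finset.sum_eq_single (⟨a + i, by omega⟩ : Fin (n + m))]
      · simp [A, C, e]
      · intro b _ hb
        have : (b : ℕ) ≠ a + i := fun h => hb (Fin.ext h)
        simp [A, e, this]
      · simp
  rw [h1, ← h2, ← Matrix.det_mul, h3, Matrix.det_fromBlocks_zero₁₂, Matrix.det_transpose]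

end Determinants

/-! ### Translations -/

theorem shift_shift (a b : ℂ) (f : Mero) : shift a (shift b f) = shift (a + b) f := by
  obtain ⟨g, hg, rfl⟩ := f.exists_mk
  simp only [shift_mk, add_assoc]

@[simp] theorem shift_zero (f : Mero) : shift 0 f = f := by
  obtain ⟨g, hg, rfl⟩ := f.exists_mk
  simp only [shift_mk, add_zero]

theorem shift_congr {a b : ℂ} (h : a = b) (f : Mero) : shift a f = shift b f := by rw [h]

theorem shift_det {k : Type*} [Fintype k] [DecidableEq k] (a : ℂ) (M : Matrix k k Mero) :
    shift a M.det = (Matrix.of fun i j => shift a (M i j)).det :=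
  RingHom.map_det _ _

/-! ### Linear independence and Casorati determinants -/

/-- If the determinant vanishes, a null vector can be normalised to have last entry $1$, the smaller
determinant being nonzero by induction. Uniqueness of such a vector forces its entries to be
$2$-periodic, which contradicts independence. -/
theorem casorati_det_ne_zero {n : ℕ} (w : Fin n → Mero) (hw : LinearIndependent PeriodTwo w) :
    (Matrix.of fun j k : Fin n => shift (2 * (k : ℂ)) (w j)).det ≠ 0 := by
  induction n with
  | zero => simp
  | succ n ih =>
    have hw' := hw.comp Fin.castSucc (Fin.castSucc_injective n)
    have hd := ih _ hw'
    intro h0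
    obtain ⟨v, hv, hvm⟩ := Matrix.exists_vecMul_eq_zero_iff.2 h0
    have hrel : ∀ k : ℕ, k ≤ n → ∑ j, v j * shift (2 * (k : ℂ)) (w j) = 0 := fun k hk => by
      simpa [Matrix.vecMul, dotProduct] using congrFun hvm ⟨k, by omega⟩
    have hlast : v (Fin.last n) ≠ 0 := by
      intro hl
      have : (fun j : Fin n => v j.castSucc) = 0 := by
        refine Matrix.eq_zero_of_vecMul_eq_zero hd ?_
        funext k
        have := hrel k (by omega)
        rwa [Fin.sum_univ_castSucc, hl, zero_mul, add_zero] at this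
      refine hv (funext fun j => ?_)
      induction j using Fin.lastCases with
      | last => exact hl
      | cast j => exact congrFun this j
    set μ : Fin n → Mero := fun j => v j.castSucc / v (Fin.last n) with hμ
    have hμrel : ∀ k : ℕ, k ≤ n → ∑ j, μ j * shift (2 * (k : ℂ)) (w j.castSucc) +
        shift (2 * (k : ℂ)) (w (Fin.last n)) = 0 := fun k hk => by
      have := hrel k hk
      rw [Fin.sum_univ_castSucc] at this
      have h2 := congrArg (fun y => (v (Fin.last n))⁻¹ * y) this
      simp only [mul_add, Finset.mul_sum, mul_zero, inv_mul_cancel_left₀ hlast] at h2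
      rw [← h2]
      congr 1
      refine Finset.sum_congr rfl fun j _ => ?_
      simp only [hμ]
      ring
    have hper : ∀ j, shift 2 (μ j) = μ j := by
      have hd2 : (Matrix.of fun j k : Fin n =>
          shift 2 (shift (2 * (k : ℂ)) (w j.castSucc))).det ≠ 0 := by
        have := (map_ne_zero (shift 2)).2 hd
        rwa [shift_det] at this
      -- Translating relation $k$ by $2$ and subtracting relation $k+1$ cancels the last function,
      -- leaving $n$ equations with invertible matrix.
      have h0 : (fun j => shift 2 (μ j) - μ j) = 0 := by
        refine Matrix.eq_zero_of_vecMul_eq_zero hd2 ?_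
        funext k
        have h1 := congrArg (shift 2) (hμrel k (by omega))
        have h2 := hμrel (k + 1) (by omega)
        have hc : (2 : ℂ) * ((k + 1 : ℕ) : ℂ) = 2 + 2 * (k : ℂ) := by push_cast; ring
        rw [hc] at h2
        simp only [map_add, map_sum, map_mul, map_zero, shift_shift] at h1
        change ∑ j, (shift 2 (μ j) - μ j) * shift 2 (shift (2 * (k : ℂ)) (w j.castSucc)) = 0
        simp only [shift_shift, sub_mul, Finset.sum_sub_distrib]
        linear_combination h1 - h2
      exact fun j => sub_eq_zero.1 (congrFun h0 j)
    have hdep : w (Fin.last n) =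
        -∑ j, (⟨μ j, hper j⟩ : PeriodTwo) • w j.castSucc := by
      have := hμrel 0 (by omega)
      simp only [Nat.cast_zero, mul_zero, shift_zero] at this
      exact eq_neg_of_add_eq_zero_right this
    have hli := Fintype.linearIndependent_iff.1 hw
      (Fin.snoc (fun j => (⟨μ j, hper j⟩ : PeriodTwo)) 1) (by
        rw [Fin.sum_univ_castSucc, hdep]
        simp) (Fin.last n)
    simp at hli

/-! ### Coefficients of difference operators -/

/-- The coefficients of `(1 - x_k D) ⋯ (1 - x_1 D) = ∑ j, lopCoeff x k j * D ^ j`. -/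
def lopCoeff (x : ℕ → Mero) : ℕ → ℕ → Mero
  | 0, 0 => 1
  | 0, _ + 1 => 0
  | k + 1, 0 => lopCoeff x k 0
  | k + 1, j + 1 => lopCoeff x k (j + 1) - x (k + 1) * shift 2 (lopCoeff x k j)

theorem lopCoeff_zero_right (x : ℕ → Mero) (k : ℕ) : lopCoeff x k 0 = 1 := by
  induction k with
  | zero => rfl
  | succ k ih => exact ih

theorem lopCoeff_eq_zero (x : ℕ → Mero) {k j : ℕ} (h : k < j) : lopCoeff x k j = 0 := by
  induction k generalizing j with
  | zero => cases j with
    | zero => omega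
    | succ j => rfl
  | succ k ih => cases j with
    | zero => omega
    | succ j => simp [lopCoeff, ih (show k < j + 1 by omega), ih (show k < j by omega)]

theorem Lop_apply (x : ℕ → Mero) (k : ℕ) (f : Mero) :
    Lop x k f = ∑ j ∈ Finset.range (k + 1), lopCoeff x k j * shift (2 * (j : ℂ)) f := by
  induction k with
  | zero => simp [Lop, lopCoeff]
  | succ k ih =>
    have h1 : Lop x (k + 1) f = Lop x k f - x (k + 1) * shift 2 (Lop x k f) := rfl
    rw [h1, ih, map_sum, Finset.mul_sum, Finset.sum_range_succ' _ (k + 1)]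
    simp only [lopCoeff, sub_mul, Finset.sum_sub_distrib]
    rw [Finset.sum_range_succ (fun j => lopCoeff x k (j + 1) * _) k,
      lopCoeff_eq_zero x (Nat.lt_succ_self k), zero_mul, add_zero,
      Finset.sum_range_succ' (fun j => lopCoeff x k j * _) k]
    have h2 : ∀ j : ℕ, x (k + 1) * shift 2 (lopCoeff x k j * shift (2 * (j : ℂ)) f) =
        x (k + 1) * shift 2 (lopCoeff x k j) * shift (2 * ((j + 1 : ℕ) : ℂ)) f := fun j => by
      rw [map_mul, shift_shift, mul_assoc,
        shift_congr (show (2 : ℂ) + 2 * j = 2 * ((j + 1 : ℕ) : ℂ) by push_cast; ring)]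
    simp only [h2]
    ring

/-- The recursion for `lopCoeff` that peels off the innermost factor. -/
theorem lopCoeff_succ_eq (x : ℕ → Mero) (k j : ℕ) :
    lopCoeff x (k + 1) (j + 1) = lopCoeff (fun b => x (b + 1)) k (j + 1) -
      lopCoeff (fun b => x (b + 1)) k j * shift (2 * (j : ℂ)) (x 1) := by
  induction k generalizing j with
  | zero => cases j <;> simp [lopCoeff]
  | succ k ih =>
    rw [lopCoeff, ih]
    cases j with
    | zero =>
      simp only [lopCoeff_zero_right, lopCoeff, map_one, Nat.cast_zero, mul_zero, shift_zero]
      ring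
    | succ j =>
      rw [ih, lopCoeff, lopCoeff, map_sub, map_mul, shift_shift,
        shift_congr (show (2 : ℂ) + 2 * j = 2 * ((j + 1 : ℕ) : ℂ) by push_cast; ring)]
      ring

/-- The top coefficient is $(-1)^kx_k(u)x_{k-1}(u+2)\cdots x_1(u+2k-2)$; `z` stands for a closed
form of this product without the sign. -/
theorem lopCoeff_diag {x z : ℕ → Mero} {n : ℕ} (h0 : z 0 = 1)
    (h : ∀ k < n, z (k + 1) = x (k + 1) * shift 2 (z k)) {k : ℕ} (hk : k ≤ n) :
    lopCoeff x k k = (-1) ^ k * z k := by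
  induction k with
  | zero => simp [lopCoeff, h0]
  | succ k ih =>
    rw [lopCoeff, lopCoeff_eq_zero x (Nat.lt_succ_self k), ih (by omega), h k (by omega), map_mul,
      map_pow, map_neg, map_one]
    ring

/-- The coefficients of `Lpart`, in terms of those of a partial product of `Lop`. -/
theorem Lpart_apply (N : ℕ) (ħ : ℂ) (x : ℕ → Mero) (f : Mero) {a : ℕ} (ha : a ≤ N + 1) :
    Lpart N ħ x a f = ∑ k ∈ Finset.range (a + 1),
      shift (2 * a - N - 1 - 2 * k + halfPeriod ħ) (lopCoeff (fun b => x (b + (N + 1 - a))) a k) *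
        shift (2 * ((a : ℂ) - k)) f := by
  induction a with
  | zero => simp [Lpart, lopCoeff]
  | succ a ih =>
    have h1 : Lpart N ħ x (a + 1) f = shift 2 (Lpart N ħ x a f) -
        shift (N + 1 - 2 * (N + 1 - a : ℕ) + halfPeriod ħ) (x (N + 1 - a)) * Lpart N ħ x a f := rfl
    have hcast : ((N + 1 - a : ℕ) : ℂ) = N + 1 - a := by
      rw [Nat.cast_sub (by omega)]; push_cast; ring
    -- The outermost factor of $L_{a+1}$ carries the lowest index, which is innermost in the partial
    -- product of $L$; hence the recursion `lopCoeff_succ_eq`.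
    set y : ℕ → Mero := fun b => x (b + (N + 1 - (a + 1))) with hy
    have hy1 : x (N + 1 - a) = y 1 := congrArg x (by omega)
    have hy2 : (fun b => x (b + (N + 1 - a))) = fun b => y (b + 1) := by
      funext b; exact congrArg x (by omega)
    rw [h1, ih (by omega), hcast, hy1, hy2, Finset.sum_range_succ' _ (a + 1), map_sum,
      Finset.mul_sum]
    simp only [lopCoeff_succ_eq, map_sub, map_mul, sub_mul, Finset.sum_sub_distrib,
      lopCoeff_zero_right, map_one, shift_shift]
    rw [Finset.sum_range_succ (fun k => shift _ (lopCoeff _ a (k + 1)) * _) a,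
      lopCoeff_eq_zero _ (Nat.lt_succ_self a), map_zero, zero_mul, add_zero,
      Finset.sum_range_succ' (fun k => shift _ (lopCoeff _ a k) * shift _ f) a]
    simp only [lopCoeff_zero_right, map_one]
    have e1 : ∀ k : ℕ, (2 : ℂ) + (2 * a - N - 1 - 2 * ((k + 1 : ℕ) : ℂ) + halfPeriod ħ) =
        2 * a - N - 1 - 2 * k + halfPeriod ħ := fun k => by push_cast; ring
    have e2 : ∀ k : ℕ, (2 : ℂ) * (((a + 1 : ℕ) : ℂ) - ((k + 1 : ℕ) : ℂ)) = 2 * (a - k) :=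
      fun k => by push_cast; ring
    have e3 : ∀ k : ℕ, (2 : ℂ) * ((a + 1 : ℕ) : ℂ) - N - 1 - 2 * ((k + 1 : ℕ) : ℂ) +
        halfPeriod ħ = 2 * a - N - 1 - 2 * k + halfPeriod ħ := fun k => by push_cast; ring
    -- The dependence on $k$ cancels, and what remains is exactly the translation built into $x'_b$.
    have e4 : ∀ k : ℕ, (2 : ℂ) * a - N - 1 - 2 * k + halfPeriod ħ + 2 * k =
        N + 1 - 2 * (N + 1 - a) + halfPeriod ħ := fun k => by ring
    have e5 : ∀ k : ℕ, (2 : ℂ) + 2 * ((a : ℂ) - ((k + 1 : ℕ) : ℂ)) = 2 * (a - k) :=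
      fun k => by push_cast; ring
    have e6 : (2 : ℂ) + 2 * ((a : ℂ) - ((0 : ℕ) : ℂ)) = 2 * (((a + 1 : ℕ) : ℂ) - ((0 : ℕ) : ℂ)) := by
      push_cast; ring
    simp only [e1, e2, e3, e4, e5, e6]
    have e7 : ∀ p q r : Mero, p * (q * r) = q * p * r := fun p q r => by ring
    simp only [e7]
    ring

/-! ### Jacobi–Trudi determinants -/

/-- The determinant `det (c_{a+j-i}(u + 1 - m + i + j))`, `0 ≤ i, j < m`. -/
def jacobiTrudi (c : ℤ → Mero) (a : ℤ) (m : ℕ) : Mero :=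
  (Matrix.of fun i j : Fin m => shift (1 - m + (i : ℕ) + (j : ℕ)) (c (a + (j : ℕ) - (i : ℕ)))).det

theorem shift_apply_congr {a b : ℂ} {y z : ℤ} (c : ℤ → Mero) (h : a = b) (hz : y = z) :
    shift a (c y) = shift b (c z) := by rw [h, hz]

/-- Dodgson condensation: the index depends on $j-i$ and the argument on $i+j$, so removing an outer
row and column moves either the argument or $a$ by $\pm1$. -/
theorem jacobiTrudi_mul_jacobiTrudi (c : ℤ → Mero) (a : ℤ) (m : ℕ) :
    shift (-1) (jacobiTrudi c a (m + 1)) * shift 1 (jacobiTrudi c a (m + 1)) =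
      jacobiTrudi c a m * jacobiTrudi c a (m + 2) +
        jacobiTrudi c (a - 1) (m + 1) * jacobiTrudi c (a + 1) (m + 1) := by
  have h := det_mul_det_interior (Matrix.of fun i j : Fin (m + 2) =>
    shift (1 - (m + 2 : ℕ) + (i : ℕ) + (j : ℕ)) (c (a + (j : ℕ) - (i : ℕ))))
  have e0 : jacobiTrudi c a m = Matrix.det (Matrix.submatrix (Matrix.of fun i j : Fin (m + 2) =>
      shift (1 - (m + 2 : ℕ) + (i : ℕ) + (j : ℕ)) (c (a + (j : ℕ) - (i : ℕ))))
      (fun i : Fin m => i.castSucc.succ) fun i : Fin m => i.castSucc.succ) := by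
    refine congrArg Matrix.det (Matrix.ext fun i j => shift_apply_congr c ?_ ?_)
    all_goals simp only [Fin.val_succ, Fin.val_castSucc]; push_cast; ring
  have e1 : shift 1 (jacobiTrudi c a (m + 1)) =
      Matrix.det (Matrix.submatrix (Matrix.of fun i j : Fin (m + 2) =>
      shift (1 - (m + 2 : ℕ) + (i : ℕ) + (j : ℕ)) (c (a + (j : ℕ) - (i : ℕ))))
      Fin.succ Fin.succ) := by
    rw [jacobiTrudi, shift_det]
    refine congrArg Matrix.det (Matrix.ext fun i j =>
      (shift_shift _ _ _).trans (shift_apply_congr c ?_ ?_))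
    all_goals simp only [Fin.val_succ]; push_cast; ring
  have e2 : shift (-1) (jacobiTrudi c a (m + 1)) =
      Matrix.det (Matrix.submatrix (Matrix.of fun i j : Fin (m + 2) =>
      shift (1 - (m + 2 : ℕ) + (i : ℕ) + (j : ℕ)) (c (a + (j : ℕ) - (i : ℕ))))
      Fin.castSucc Fin.castSucc) := by
    rw [jacobiTrudi, shift_det]
    refine congrArg Matrix.det (Matrix.ext fun i j =>
      (shift_shift _ _ _).trans (shift_apply_congr c ?_ rfl))
    simp only [Fin.val_castSucc]; push_cast; ring
  have e3 : jacobiTrudi c (a - 1) (m + 1) =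
      Matrix.det (Matrix.submatrix (Matrix.of fun i j : Fin (m + 2) =>
      shift (1 - (m + 2 : ℕ) + (i : ℕ) + (j : ℕ)) (c (a + (j : ℕ) - (i : ℕ))))
      Fin.succ Fin.castSucc) := by
    refine congrArg Matrix.det (Matrix.ext fun i j => shift_apply_congr c ?_ ?_)
    all_goals simp only [Fin.val_succ, Fin.val_castSucc]; push_cast; ring
  have e4 : jacobiTrudi c (a + 1) (m + 1) =
      Matrix.det (Matrix.submatrix (Matrix.of fun i j : Fin (m + 2) =>
      shift (1 - (m + 2 : ℕ) + (i : ℕ) + (j : ℕ)) (c (a + (j : ℕ) - (i : ℕ))))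
      Fin.castSucc Fin.succ) := by
    refine congrArg Matrix.det (Matrix.ext fun i j => shift_apply_congr c ?_ ?_)
    all_goals simp only [Fin.val_succ, Fin.val_castSucc]; push_cast; ring
  rw [← e0, ← e1, ← e2, ← e3, ← e4] at h
  change jacobiTrudi c a (m + 2) * _ = _ at h
  linear_combination -h

/-- The translations are symmetric in $i,j$, so reflecting the index amounts to transposing the
matrix. -/
theorem jacobiTrudi_dual {c : ℤ → Mero} {ε : Mero} {h : ℂ} {n : ℤ}
    (hc : ∀ z, c (n - z) = ε * shift h (c z)) (hε : ∀ s, shift s ε = ε) (a : ℤ) (m : ℕ) :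
    jacobiTrudi c (n - a) m = ε ^ m * shift h (jacobiTrudi c a m) := by
  have e : (Matrix.of fun i j : Fin m =>
      shift (1 - m + (i : ℕ) + (j : ℕ)) (c (n - a + (j : ℕ) - (i : ℕ)))) =
      ε • (Matrix.of fun i j : Fin m => shift h
        (shift (1 - m + (i : ℕ) + (j : ℕ)) (c (a + (j : ℕ) - (i : ℕ))))).transpose := by
    ext1 i j
    change shift _ _ = ε * shift _ (shift _ _)
    rw [show n - a + ((j : ℕ) : ℤ) - ((i : ℕ) : ℤ) = n - (a + (i : ℕ) - (j : ℕ)) by ring, hc,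
      map_mul, hε, shift_shift, shift_shift]
    congr 1
    exact shift_apply_congr c (by ring) rfl
  rw [jacobiTrudi, e, Matrix.det_smul, Fintype.card_fin, Matrix.det_transpose, jacobiTrudi,
    shift_det]
  rfl

/-- The coefficients `c_k(u - k)` of `(1 - x_n D) ⋯ (1 - x_1 D) = ∑ k, c_k(u) D ^ k`. -/
def centredCoeff (x : ℕ → Mero) (n : ℕ) (k : ℤ) : Mero :=
  if 0 ≤ k then shift (-k) (lopCoeff x n k.toNat) else 0

theorem centredCoeff_natCast (x : ℕ → Mero) (n k : ℕ) :
    centredCoeff x n k = shift (-k) (lopCoeff x n k) := by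
  simp [centredCoeff]

theorem jacobiTrudi_centredCoeff_zero (x : ℕ → Mero) (n m : ℕ) :
    jacobiTrudi (centredCoeff x n) 0 m = 1 := by
  rw [jacobiTrudi, Matrix.det_of_isUpperTriangular]
  · refine Finset.prod_eq_one fun i _ => ?_
    have : (0 : ℤ) + ((i : ℕ) : ℤ) - ((i : ℕ) : ℤ) = (0 : ℕ) := by simp
    simp only [Matrix.of_apply]
    rw [this, centredCoeff_natCast, lopCoeff_zero_right, map_one, map_one]
  · intro i j hij
    have hlt : (j : ℕ) < i := hij
    have : ¬ (0 : ℤ) ≤ 0 + ((j : ℕ) : ℤ) - ((i : ℕ) : ℤ) := by omega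
    simp only [Matrix.of_apply]
    rw [centredCoeff, if_neg this, map_zero]

/-! ### The Casorati solution -/

section Casorati

variable {N : ℕ} {x : ℕ → Mero} {w : Fin (N + 1) → Mero}

theorem xi0_ne_zero (hw : LinearIndependent PeriodTwo w) : xi0 w ≠ 0 := by
  have h := casorati_det_ne_zero w hw
  simpa only [xi0, casorati, Int.cast_natCast] using h

/-- `c_{N+1-k}(u) = (-1)^{N+1} c_k(u + N + 1 - 2k + π i / (2 ħ))` for the coefficients of `L`. -/
theorem lopCoeff_dual {ħ : ℂ} (hxi : xi0 w ≠ 0) (hL : ∀ j, Lop x (N + 1) (w j) = 0)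
    (hP : ∀ j, Lpart N ħ x (N + 1) (w j) = 0)
    (hdiag : lopCoeff x (N + 1) (N + 1) = (-1) ^ (N + 1)) {k l : ℕ} (hkl : l + k = N + 1) :
    lopCoeff x (N + 1) l =
      (-1) ^ (N + 1) * shift ((l : ℂ) - k + halfPeriod ħ) (lopCoeff x (N + 1) k) := by
  -- The coefficients of $L-(-1)^{N+1}L_{N+1}$. The term of order $N+1$ cancels by `hdiag`, so
  -- invertibility of the Casorati matrix kills the rest.
  set d : ℕ → Mero := fun j => lopCoeff x (N + 1) j - (-1) ^ (N + 1) *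
    shift ((j : ℂ) - (N + 1 - j : ℕ) + halfPeriod ħ) (lopCoeff x (N + 1) (N + 1 - j)) with hd
  have hlast : d (N + 1) = 0 := by
    simp [hd, hdiag, lopCoeff_zero_right]
  have hsum : ∀ i, ∑ j ∈ Finset.range (N + 1), d j * shift (2 * (j : ℂ)) (w i) = 0 := fun i => by
    have h1 := hL i
    have h2 := hP i
    rw [Lop_apply] at h1
    rw [Lpart_apply N ħ x (w i) le_rfl, ← Finset.sum_range_reflect] at h2
    have h3 : ∑ j ∈ Finset.range (N + 1 + 1), d j * shift (2 * (j : ℂ)) (w i) = 0 := by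
      simp only [hd, sub_mul, Finset.sum_sub_distrib, mul_assoc, ← Finset.mul_sum]
      rw [h1, zero_sub, neg_eq_zero]
      refine mul_eq_zero_of_right _ (Eq.trans (Finset.sum_congr rfl fun j hj => ?_) h2)
      have hj' : j ≤ N + 1 := Nat.lt_succ_iff.1 (Finset.mem_range.1 hj)
      rw [show N + 1 + 1 - 1 - j = N + 1 - j by omega, Nat.sub_self]
      have hc : ((N + 1 - j : ℕ) : ℂ) = N + 1 - j := by
        rw [Nat.cast_sub hj']; push_cast; ring
      rw [hc]
      congr 1
      · refine congrArg₂ (fun s y => shift s y) ?_ rfl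
        push_cast; ring
      · refine shift_congr ?_ _
        push_cast; ring
    rwa [Finset.sum_range_succ, hlast, zero_mul, add_zero] at h3
  have hzero : (fun j : Fin (N + 1) => d j) = 0 := by
    refine Matrix.eq_zero_of_mulVec_eq_zero hxi ?_
    funext i
    change ∑ j : Fin (N + 1), shift (2 * (((j : ℕ) : ℤ) : ℂ)) (w i) * d j = 0
    rw [← hsum i, ← Fin.sum_univ_eq_sum_range fun j => d j * shift (2 * (j : ℂ)) (w i)]
    refine Finset.sum_congr rfl fun j _ => ?_
    rw [Int.cast_natCast, mul_comm]
  have hdl : d l = 0 := by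
    rcases Nat.lt_or_ge l (N + 1) with h | h
    · exact congrFun hzero ⟨l, h⟩
    · rw [show l = N + 1 by omega, hlast]
  rw [hd] at hdl
  simp only [show N + 1 - l = k by omega] at hdl
  exact sub_eq_zero.1 hdl

/-- Centring absorbs the translation $l-k$ and leaves only the half period; outside $0,\dots,N+1$
both sides vanish. -/
theorem centredCoeff_dual {ħ : ℂ} (hxi : xi0 w ≠ 0) (hL : ∀ j, Lop x (N + 1) (w j) = 0)
    (hP : ∀ j, Lpart N ħ x (N + 1) (w j) = 0)
    (hdiag : lopCoeff x (N + 1) (N + 1) = (-1) ^ (N + 1)) (z : ℤ) :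
    centredCoeff x (N + 1) ((N + 1 : ℕ) - z) =
      (-1) ^ (N + 1) * shift (halfPeriod ħ) (centredCoeff x (N + 1) z) := by
  rcases lt_or_ge z 0 with hz | hz
  · obtain ⟨l, hl⟩ := Int.eq_ofNat_of_zero_le (show 0 ≤ ((N + 1 : ℕ) : ℤ) - z by omega)
    rw [hl, centredCoeff_natCast, lopCoeff_eq_zero x (by omega), centredCoeff, if_neg (by omega)]
    simp
  obtain ⟨k, rfl⟩ := Int.eq_ofNat_of_zero_le hz
  rcases Nat.lt_or_ge (N + 1) k with hk | hk
  · rw [centredCoeff_natCast, lopCoeff_eq_zero x hk, centredCoeff, if_neg (by omega)]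
    simp
  · obtain ⟨l, hl⟩ := Nat.exists_eq_add_of_le' hk
    rw [show ((N + 1 : ℕ) : ℤ) - (k : ℤ) = (l : ℕ) by omega, centredCoeff_natCast,
      centredCoeff_natCast, lopCoeff_dual hxi hL hP hdiag hl.symm, map_mul, map_pow, map_neg,
      map_one, shift_shift, shift_shift]
    congr 1
    exact shift_congr (by ring) _

theorem T_natCast (hxi : xi0 w ≠ 0) (hL : ∀ j, Lop x (N + 1) (w j) = 0)
    (hdiag : lopCoeff x (N + 1) (N + 1) = (-1) ^ (N + 1)) {a : ℕ} (ha : a ≤ N + 1) (m : ℕ) :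
    T w a m = (-1) ^ (a * m) * jacobiTrudi (centredCoeff x (N + 1)) a m := by
  -- Row $i$ of $B$ lists the coefficients of $D^iL$.
  have h := det_skip_columns ha m (fun j k => shift (2 * (k : ℂ)) (w j))
    (fun i k => if i ≤ k then shift (2 * (i : ℂ)) (lopCoeff x (N + 1) (k - i)) else 0) ?_ ?_
  · have e1 : (Matrix.of fun (i k : Fin (N + 1)) =>
        shift (2 * ((if (k : ℕ) < a then (k : ℕ) else k + m : ℕ) : ℂ)) (w i)).det = xi w a m := by
      refine congrArg Matrix.det (Matrix.ext fun i k => shift_congr ?_ _)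
      split_ifs with hk <;> simp [hk]
    have e2 : (Matrix.of fun (i k : Fin (N + 1)) => shift (2 * ((k : ℕ) : ℂ)) (w i)).det =
        xi0 w := by
      refine congrArg Matrix.det (Matrix.ext fun i k => shift_congr ?_ _)
      push_cast; rfl
    have e3 : ∏ i : Fin m, (if (i : ℕ) ≤ N + 1 + i then
        shift (2 * ((i : ℕ) : ℂ)) (lopCoeff x (N + 1) (N + 1 + i - i)) else 0) =
        (-1) ^ ((N + 1) * m) := by
      simp [hdiag, ← pow_mul]
    rw [e1, e2, e3] at h
    have e4 : shift (-a - m + 1) (Matrix.of fun (i k : Fin m) => if (i : ℕ) ≤ a + k then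
        shift (2 * ((i : ℕ) : ℂ)) (lopCoeff x (N + 1) (a + k - i)) else 0).det =
        jacobiTrudi (centredCoeff x (N + 1)) a m := by
      rw [shift_det]
      refine congrArg Matrix.det (Matrix.ext fun i k => ?_)
      simp only [Matrix.of_apply]
      split_ifs with hik
      · rw [show (a : ℤ) + ((k : ℕ) : ℤ) - ((i : ℕ) : ℤ) = ((a + k - i : ℕ) : ℤ) by omega,
          centredCoeff_natCast, shift_shift, shift_shift]
        refine shift_congr ?_ _
        rw [Nat.cast_sub hik]
        push_cast; ring
      · rw [centredCoeff, if_neg (by omega), map_zero, map_zero]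
    have hs : ((-1 : Mero) ^ ((N + 1) * m)) * (-1) ^ ((N + 1) * m) = 1 := by
      rw [← mul_pow]; simp
    have hs2 : ((-1 : Mero) ^ (a * m)) * (-1) ^ (a * m) = 1 := by
      rw [← mul_pow]; simp
    have h5 : xi w a m = (-1) ^ (a * m) * (xi0 w * (Matrix.of fun (i k : Fin m) =>
        if (i : ℕ) ≤ a + k then
        shift (2 * ((i : ℕ) : ℂ)) (lopCoeff x (N + 1) (a + k - i)) else 0).det) := by
      rw [← h, show m * (N + 1 + a) = (N + 1) * m + a * m by ring, pow_add]
      linear_combination (-(xi w a m) * ((-1) ^ (a * m)) * ((-1) ^ (a * m))) * hs -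
        xi w a m * hs2
    have hne : shift (-a - m + 1) (xi0 w) ≠ 0 := (map_ne_zero _).2 hxi
    rw [T, Int.cast_natCast, div_eq_iff hne, h5, map_mul, map_mul, e4]
    simp only [map_pow, map_neg, map_one]
    ring
  · intro j i hi
    have hLj := congrArg (shift (2 * (i : ℂ))) (hL j)
    rw [Lop_apply, map_sum, map_zero] at hLj
    rw [Fin.sum_univ_eq_sum_range fun k => shift (2 * (k : ℂ)) (w j) *
      if i ≤ k then shift (2 * (i : ℂ)) (lopCoeff x (N + 1) (k - i)) else 0]
    obtain ⟨r, rfl⟩ : ∃ r, m = i + (r + 1) := ⟨m - i - 1, by omega⟩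
    -- Only the $N+2$ columns from $i$ to $i+N+1$ contribute, and they give $(Lw_j)(u+2i)=0$.
    rw [show N + 1 + (i + (r + 1)) = i + (N + 1 + 1 + r) by ring, Finset.sum_range_add,
      Finset.sum_eq_zero, zero_add, Finset.sum_range_add]
    · refine Eq.trans (congrArg₂ (· + ·) (Finset.sum_congr rfl fun k _ => ?_)
        (Finset.sum_eq_zero fun k _ => ?_)) ((add_zero _).trans hLj)
      · rw [if_pos (by omega), map_mul, shift_shift, Nat.add_sub_cancel_left, mul_comm]
        congr 1
        exact shift_congr (by push_cast; ring) _
      · rw [if_pos (by omega), lopCoeff_eq_zero x (by omega), map_zero, mul_zero]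
    · intro k hk
      rw [if_neg (by simpa using hk), mul_zero]
  · intro i k hik
    rw [if_pos (by omega), lopCoeff_eq_zero x (by omega), map_zero]

/-- The columns in positions $a-1$ and $a$ both carry the shift index $a-1$. -/
theorem xi_neg_one {a : ℕ} (ha : 1 ≤ a) (haN : a ≤ N) : xi w a (-1) = 0 := by
  refine Matrix.det_zero_of_column_eq (i := ⟨a - 1, by omega⟩) (j := ⟨a, by omega⟩) ?_ fun i => ?_
  · simp only [ne_eq, Fin.mk.injEq]; omega
  · refine shift_congr ?_ _
    dsimp only
    rw [if_pos (show a - 1 < a by omega), if_neg (lt_irrefl a)]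
    push_cast [Nat.cast_sub ha]
    ring

theorem IsAdaptedBasis.Lop_eq_zero {ħ : ℂ} (hw : IsAdaptedBasis ħ x w) (j : Fin (N + 1)) :
    Lop x (N + 1) (w j) = 0 := by
  have h : w j ∈ Submodule.span PeriodTwo (Set.range w) := Submodule.subset_span ⟨j, rfl⟩
  rwa [hw.span_eq] at h

theorem IsAdaptedBasis.isBoundary {ħ : ℂ} (hw : IsAdaptedBasis ħ x w)
    (hdiag : lopCoeff x (N + 1) (N + 1) = (-1) ^ (N + 1)) {n : ℕ} (hn : n ≤ N) :
    IsBoundary n (T w) where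
  neg_one a ha han := by rw [T, xi_neg_one ha (han.trans hn), map_zero, zero_div]
  zero a _ _ := by
    have hxi : xi w a 0 = xi0 w :=
      congrArg Matrix.det (Matrix.ext fun i k => shift_congr (by simp) _)
    rw [T, hxi]
    exact div_self ((map_ne_zero _).2 (xi0_ne_zero hw.linearIndependent))
  left m hm := by
    obtain ⟨m, rfl⟩ := Int.eq_ofNat_of_zero_le hm
    -- At $a=0$ the Jacobi–Trudi matrix is unitriangular; equivalently, $\xi$ is $2$-periodic.
    rw [T_natCast (xi0_ne_zero hw.linearIndependent) hw.Lop_eq_zero hdiag (Nat.zero_le _),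
      Nat.cast_zero, jacobiTrudi_centredCoeff_zero]
    simp

/-- The duality that folds the Dynkin diagram of `A_N`. -/
theorem IsAdaptedBasis.T_dual {ħ : ℂ} (hw : IsAdaptedBasis ħ x w)
    (hdiag : lopCoeff x (N + 1) (N + 1) = (-1) ^ (N + 1)) {a b : ℕ} (hab : b + a = N + 1)
    {m : ℤ} (hm : 0 ≤ m) : T w b m = shift (halfPeriod ħ) (T w a m) := by
  obtain ⟨m, rfl⟩ := Int.eq_ofNat_of_zero_le hm
  have hxi := xi0_ne_zero hw.linearIndependent
  have hd := jacobiTrudi_dual (centredCoeff_dual hxi hw.Lop_eq_zero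
    (fun j => hw.adapted (N + 1) j le_rfl j.2) hdiag) (fun s => by simp) a m
  rw [T_natCast hxi hw.Lop_eq_zero hdiag (by omega), T_natCast hxi hw.Lop_eq_zero hdiag (by omega),
    show (b : ℤ) = (N + 1 : ℕ) - (a : ℤ) by omega, hd, ← hab]
  simp only [map_mul, map_pow, map_neg, map_one, ← pow_mul]
  have hs : ((-1 : Mero) ^ (b * m)) * (-1) ^ (b * m) = 1 := by
    rw [← mul_pow]; simp
  rw [add_mul, pow_add]
  linear_combination ((-1) ^ (a * m) *
    shift (halfPeriod ħ) (jacobiTrudi (centredCoeff x (b + a)) a m)) * hs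

/-- The Dodgson relation for the $c_k$; the signs $(-1)^{am}$ drop out because each of the three
products has even total exponent. -/
theorem IsAdaptedBasis.T_mul_T {ħ : ℂ} (hw : IsAdaptedBasis ħ x w)
    (hdiag : lopCoeff x (N + 1) (N + 1) = (-1) ^ (N + 1)) {a : ℕ} (ha : 1 ≤ a) (haN : a ≤ N)
    {m : ℤ} (hm : 1 ≤ m) :
    shift (-1) (T w a m) * shift 1 (T w a m) =
      T w a (m - 1) * T w a (m + 1) + T w (a - 1) m * T w (a + 1) m := by
  obtain ⟨m, rfl⟩ : ∃ k : ℕ, m = (k + 1 : ℕ) := ⟨(m - 1).toNat, by omega⟩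
  obtain ⟨a, rfl⟩ : ∃ b, a = b + 1 := ⟨a - 1, by omega⟩
  have hT : ∀ (b k : ℕ), b ≤ N + 1 →
      T w b k = (-1) ^ (b * k) * jacobiTrudi (centredCoeff x (N + 1)) b k :=
    fun b k hb => T_natCast (xi0_ne_zero hw.linearIndependent) hw.Lop_eq_zero hdiag hb k
  have h := jacobiTrudi_mul_jacobiTrudi (centredCoeff x (N + 1)) (a + 1 : ℕ) m
  rw [show ((m + 1 : ℕ) : ℤ) - 1 = m by omega, show ((m + 1 : ℕ) : ℤ) + 1 = (m + 2 : ℕ) by omega,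
    hT _ _ (by omega), hT _ _ (by omega), hT _ _ (by omega), hT _ _ (by omega), hT _ _ (by omega),
    Nat.add_sub_cancel]
  rw [show ((a + 1 : ℕ) : ℤ) - 1 = a by omega,
    show ((a + 1 : ℕ) : ℤ) + 1 = (a + 1 + 1 : ℕ) by omega] at h
  simp only [map_mul, map_pow, map_neg, map_one]
  have hs : ∀ k : ℕ, (-1 : Mero) ^ (2 * k) = 1 := fun k => by rw [pow_mul]; simp
  have s1 : (-1 : Mero) ^ ((a + 1) * (m + 1)) * (-1) ^ ((a + 1) * (m + 1)) = 1 := by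
    rw [← pow_add, ← two_mul, hs]
  have s2 : (-1 : Mero) ^ ((a + 1) * m) * (-1) ^ ((a + 1) * (m + 2)) = 1 := by
    rw [← pow_add, show (a + 1) * m + (a + 1) * (m + 2) = 2 * ((a + 1) * (m + 1)) by ring, hs]
  have s3 : (-1 : Mero) ^ (a * (m + 1)) * (-1) ^ ((a + 1 + 1) * (m + 1)) = 1 := by
    rw [← pow_add, show a * (m + 1) + (a + 1 + 1) * (m + 1) = 2 * ((a + 1) * (m + 1)) by ring, hs]
  rw [mul_mul_mul_comm, s1, mul_mul_mul_comm, s2, mul_mul_mul_comm, s3, one_mul, one_mul, one_mul,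
    h]

end Casorati

/-! ### Telescoping products of the variables -/

theorem Y_ne_zero {Q : ℕ → Mero} {n : ℕ} (hQ : ∀ a, 1 ≤ a → a ≤ n → Q a ≠ 0) {a : ℕ}
    (ha : a ≤ n) : Y Q a ≠ 0 := by
  cases a with
  | zero => exact one_ne_zero
  | succ a =>
    have := hQ (a + 1) (by omega) ha
    exact div_ne_zero ((map_ne_zero _).2 this) ((map_ne_zero _).2 this)

/-- The partial products telescope to $Y_k(u+k)$ up to the middle and to $Y_{N+1-k}(u+k+\frac{\pi
i}{2\hbar})$ after it, ending at $Y_0=1$. -/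
theorem lopCoeff_xEven {n : ℕ} {ħ : ℂ} {Q : ℕ → Mero} (hQ : ∀ a, 1 ≤ a → a ≤ n → Q a ≠ 0) :
    lopCoeff (xEven n ħ Q) (2 * n + 1) (2 * n + 1) = (-1) ^ (2 * n + 1) := by
  have key := lopCoeff_diag (x := xEven n ħ Q)
    (z := fun k => if k ≤ n then shift k (Y Q k) else shift (k + halfPeriod ħ) (Y Q (2 * n + 1 - k)))
    (n := 2 * n + 1) (by simp [Y]) ?_ le_rfl
  · rw [key]
    simp [show ¬ 2 * n + 1 ≤ n by omega, Y]
  intro k hk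
  have hY : ∀ a (s : ℂ), a ≤ n → shift s (Y Q a) ≠ 0 := fun a s ha =>
    (map_ne_zero _).2 (Y_ne_zero hQ ha)
  rcases lt_trichotomy k n with h | h | h
  · rw [if_pos (by omega), if_pos (by omega), xEven, if_pos (by omega), Nat.add_sub_cancel,
      shift_shift, shift_congr (show (2 : ℂ) + k = ((k + 1 : ℕ) : ℂ) + 1 by push_cast; ring),
      div_mul_cancel₀ _ (hY _ _ (by omega))]
  · subst h
    rw [if_neg (by omega), if_pos le_rfl, xEven, if_neg (by omega), if_pos rfl, shift_shift,
      shift_congr (show (2 : ℂ) + k = k + 2 by ring), div_mul_cancel₀ _ (hY _ _ le_rfl),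
      show 2 * k + 1 - (k + 1) = k by omega]
    exact shift_congr (by push_cast; ring) _
  · rw [if_neg (by omega), if_neg (by omega), xEven, if_neg (by omega), if_neg (by omega)]
    obtain ⟨a, ha⟩ : ∃ a, 2 * n = k + a := ⟨2 * n - k, by omega⟩
    have hc : (2 : ℂ) * n = k + a := by exact_mod_cast ha
    dsimp only
    rw [show 2 * n + 2 - (k + 1) = a + 1 by omega, show 2 * n + 1 - (k + 1) = a by omega,
      show 2 * n + 1 - k = a + 1 by omega, Nat.add_sub_cancel, shift_shift, hc,
      shift_congr (show (2 : ℂ) + (k + halfPeriod ħ) =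
        k + a - ((a + 1 : ℕ) : ℂ) + 3 + halfPeriod ħ by push_cast; ring),
      div_mul_cancel₀ _ (hY _ _ (by omega))]
    exact shift_congr (by push_cast; ring) _

/-- Telescoping as for $N=2n$, except that the middle partial product is $Y_n^2(u+n)$. -/
theorem lopCoeff_xOdd {n : ℕ} {ħ : ℂ} {Q : ℕ → Mero} (hn : 1 ≤ n)
    (hQ : ∀ a, 1 ≤ a → a ≤ n → Q a ≠ 0) :
    lopCoeff (xOdd n ħ Q) (2 * n) (2 * n) = (-1) ^ (2 * n) := by
  have key := lopCoeff_diag (x := xOdd n ħ Q)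
    (z := fun k => if k < n then shift k (Y Q k) else if k = n then shift n (YY ħ Q n) else
      shift (k + halfPeriod ħ) (Y Q (2 * n - k)))
    (n := 2 * n) (by simp [Y, show 0 < n by omega]) ?_ le_rfl
  · rw [key]
    simp [show ¬ 2 * n < n by omega, show ¬ 2 * n = n by omega, Y]
  intro k hk
  have hY : ∀ a (s : ℂ), a ≤ n → shift s (Y Q a) ≠ 0 := fun a s ha =>
    (map_ne_zero _).2 (Y_ne_zero hQ ha)
  have hYY : ∀ s : ℂ, shift s (YY ħ Q n) ≠ 0 := fun s =>
    (map_ne_zero _).2 (mul_ne_zero (Y_ne_zero hQ le_rfl) (hY _ _ le_rfl))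
  rcases Nat.lt_or_ge (k + 1) n with h | h
  · rw [if_pos (by omega), if_pos (by omega), xOdd, if_pos (by omega), Nat.add_sub_cancel,
      shift_shift, shift_congr (show (2 : ℂ) + k = ((k + 1 : ℕ) : ℂ) + 1 by push_cast; ring),
      div_mul_cancel₀ _ (hY _ _ (by omega))]
  rcases Nat.eq_or_lt_of_le h with h | h
  · subst h
    rw [if_neg (by omega), if_pos rfl, if_pos (by omega), xOdd, if_neg (by omega), if_pos rfl,
      Nat.add_sub_cancel, shift_shift,
      shift_congr (show (2 : ℂ) + k = ((k + 1 : ℕ) : ℂ) + 1 by push_cast; ring),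
      div_mul_cancel₀ _ (hY _ _ (by omega))]
  rcases Nat.eq_or_lt_of_le (Nat.lt_succ_iff.1 h) with h | h
  · subst h
    rw [if_neg (by omega), if_neg (by omega), if_neg (by omega), if_pos rfl, xOdd,
      if_neg (by omega), if_neg (by omega), if_pos rfl, shift_shift,
      shift_congr (show (2 : ℂ) + n = n + 2 by ring), div_mul_cancel₀ _ (hYY _),
      show 2 * n - (n + 1) = n - 1 by omega]
    exact shift_congr (by push_cast; ring) _
  · rw [if_neg (by omega), if_neg (by omega), if_neg (by omega), if_neg (by omega), xOdd,
      if_neg (by omega), if_neg (by omega), if_neg (by omega)]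
    obtain ⟨a, ha⟩ : ∃ a, 2 * n = k + (a + 1) := ⟨2 * n - k - 1, by omega⟩
    have hc : (2 : ℂ) * n = k + (a + 1) := by exact_mod_cast ha
    dsimp only
    rw [show 2 * n + 1 - (k + 1) = a + 1 by omega, show 2 * n - (k + 1) = a by omega,
      show 2 * n - k = a + 1 by omega, Nat.add_sub_cancel, shift_shift, hc,
      shift_congr (show (2 : ℂ) + (k + halfPeriod ħ) =
        k + (a + 1) - ((a + 1 : ℕ) : ℂ) + 2 + halfPeriod ħ by push_cast; ring),
      div_mul_cancel₀ _ (hY _ _ (by omega))]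
    exact shift_congr (by push_cast; ring) _

end TwistedT

end

theorem theorem1 (ħ : ℂ) (hħ : ħ ≠ 0) (n : ℕ) (Q : ℕ → TwistedT.Mero)
    (hQ : ∀ a, 1 ≤ a → a ≤ n → Q a ≠ 0)
    (hper : ∀ a, 1 ≤ a → a ≤ n → ∃ h : ℂ,
      TwistedT.shift (Real.pi * Complex.I / ħ) (Q a) = TwistedT.const h * Q a) :
    (1 ≤ n → ∀ w : Fin (2 * n + 1) → TwistedT.Mero,
      TwistedT.IsAdaptedBasis ħ (TwistedT.xEven n ħ Q) w →
        TwistedT.xi0 w ≠ 0 ∧ TwistedT.IsTSystemEven n ħ (TwistedT.T w)) ∧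
    (2 ≤ n → ∀ w : Fin ((2 * n - 1) + 1) → TwistedT.Mero,
      TwistedT.IsAdaptedBasis ħ (TwistedT.xOdd n ħ Q) w →
        TwistedT.xi0 w ≠ 0 ∧ TwistedT.IsTSystemOdd n ħ (TwistedT.T w)) := by
  refine ⟨fun hn w hw => ?_, fun hn w hw => ?_⟩
  · have hd := TwistedT.lopCoeff_xEven (ħ := ħ) hQ
    refine ⟨TwistedT.xi0_ne_zero hw.linearIndependent, hw.isBoundary hd (by omega),
      fun a m ha han hm => hw.T_mul_T hd ha (by omega) hm, fun m hm => ?_⟩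
    -- For $N=2n$ node $n+1$ is dual to node $n$ itself.
    rw [hw.T_mul_T hd hn (by omega) hm,
      hw.T_dual hd (show n + 1 + n = 2 * n + 1 by omega) (by omega)]
  · have hd : TwistedT.lopCoeff (TwistedT.xOdd n ħ Q) (2 * n - 1 + 1) (2 * n - 1 + 1) =
        (-1) ^ (2 * n - 1 + 1) := by
      rw [show 2 * n - 1 + 1 = 2 * n by omega]
      exact TwistedT.lopCoeff_xOdd (by omega) hQ
    refine ⟨TwistedT.xi0_ne_zero hw.linearIndependent, hw.isBoundary hd (by omega),
      fun a m ha han hm => hw.T_mul_T hd ha (by omega) hm, fun m hm => ?_⟩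
    -- For $N=2n-1$ node $n$ is self-dual, and node $n+1$ is dual to $n-1$.
    rw [hw.T_mul_T hd (by omega) (by omega) hm,
      hw.T_dual hd (show n + 1 + (n - 1) = 2 * n - 1 + 1 by omega) (by omega)]
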